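/- **Conventions.** Ordinals are identified with the sets of smaller ordinals and cardinals with initial ordinals. $\mathrm{lg}(\eta)$ is the length of a sequence $\eta$ of ordinals, ${}^{\delta>}\delta$ is the set of sequences of length $<\delta$ with entries $<\delta$, and $\eta\triangleleft\nu$ means that $\eta$ is a proper initial segment of $\nu$. For $\mathcal T\subseteq{}^{\delta>}\delta$ put $\mathrm{Suc}_{\mathcal T}(\eta)=\{\zeta:\eta^\frown\langle\zeta\rangle\in\mathcal T\}$, and let $\lim_\delta(\mathcal T)$ be the set of sequences $\eta$ of length $\delta$ with $\eta\restriction\alpha\in\mathcal T$ for all $\alpha<\delta$. A filter $D$ on a set $X$ is *$(\kappa,\theta)$-regular* if there are $A_\alpha\in D$ $(\alpha<\kappa)$ such that $|\{\alpha<\kappa:x\in A_\alpha\}|<\theta$ for every $x\in X$. It is *$\theta$-complete* if the intersection of fewer than $\theta$ members of $D$ is in $D$. A filter $D$ on an infinite cardinal $\mu$ is called *uniform* here if every member of $D$ has cardinality $\mu$ and every co-bounded subset of $\mu$ is in $D$. **Special trees and pairs.** A *$\delta$-special tree* is a set $\mathcal T\subseteq{}^{\delta>}\delta$ that contains $\langle\rangle$,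 is closed under initial segments, has no $\triangleleft$-maximal element, and is closed: if $\eta\in{}^{\delta>}\delta$ and $\eta\restriction(\alpha+1)\in\mathcal T$ for all $\alpha<\mathrm{lg}(\eta)$, then $\eta\in\mathcal T$. It is *$\theta$-lean* if for every $\alpha<\delta$ fewer than $\theta$ of the $\eta\in\mathcal T$ of length $\alpha$ are such that $\mathrm{Suc}_{\mathcal T}(\eta)$ is not a singleton. For cardinals $\kappa\ge\theta$ with $\theta$ infinite and regular and a limit ordinal $\delta\ge\kappa$, $(D,\mathcal T)$ is a *$(\delta,\kappa,\theta)$-special pair* if $D$ is a $(\kappa,\theta)$-regular filter on $\delta$, $\mathcal T$ is a $\delta$-special tree, and for every $\eta\in\lim_\delta(\mathcal T)$ the set $\{\alpha<\delta:\mathrm{Suc}_{\mathcal T}(\eta\restriction\alpha)\text{ is not a singleton}\}$ is in $D$. **1-special filters.** $D$ is a *$(\mu,S,\kappa,\theta,\mathbf f)$-1-special filter* if $\mu$ is an uncountable cardinal, $S\subseteq\mu$, $|S|=\mu$; $\theta$ is an infinite regular cardinal and $\kappa\ge\theta$ a cardinal; $D$ is a $(\kappa,\theta)$-regular, uniform,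 $\theta$-complete filter on $\mu$ with $S\in D$; $\mathbf f:\mu\to\mu\setminus\{0\}$; and there are $\mathcal F_\alpha\subseteq\prod_{i<\alpha}\mathbf f(i)$ for $\alpha\in S$ with $|\mathcal F_\alpha|<\theta$ such that for every $g\in\prod_{i<\mu}\mathbf f(i)$ the set $\{\alpha\in S:g\restriction\alpha\in\mathcal F_\alpha\}$ is in $D$. **2-special pairs.** $(D,\mathcal T)$ is a *$(\mu,S,\kappa,\theta,\mathbf f)$-2-special pair* if $\mu\ge\kappa>\theta$, $\theta$ is an infinite regular cardinal, $S\subseteq\mu=\sup(S)$, $\mathbf f:\mu\to\mu+1$, $D$ is a $(\mu,S,\kappa,\theta,\mathbf f)$-1-special filter (so $D$ is $\theta$-complete and $S\in D$), $\mathcal T\subseteq\bigcup_{\alpha<\mu}\prod_{\beta<\alpha}\mathbf f(\beta)$ has cardinality at most $\mu$ and is a $\theta$-lean $\mu$-special tree, $(D,\mathcal T)$ is a $(\mu,\kappa,\theta)$-special pair, and $\mathrm{Suc}_{\mathcal T}(\eta)=\mathbf f(\mathrm{lg}(\eta))$ whenever $\eta\in\mathcal T$ and $\mathrm{Suc}_{\mathcal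 T}(\eta)$ is not a singleton. **Statement.** Let $\mu$ be an uncountable cardinal, $0<\sigma<\mu$, and let $\mathbf f$ be the function on $\mu$ with constant value $\sigma$. Assume that $2^\kappa=\kappa^+$ for every infinite cardinal $\kappa<\mu$ and, if $\mu=\aleph_1$, assume moreover Jensen's diamond $\diamondsuit_{\aleph_1}$. Then: 1. there is a $(\mu,\mu,\mu,\aleph_0,\mathbf f)$-1-special filter; 2. if moreover $\sigma\ge 2$, there is a $(\mu,\mu,\mu,\aleph_0,\mathbf f)$-2-special pair $(D,\mathcal T)$. -/

import Mathlib

universe u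

open Cardinal Set

/-- A sequence of ordinals of ordinal length. The entries beyond the length are set to `0`, so that
equality in this type is equality of sequences (same length and same entries). -/
@[ext]
structure OrdSeq : Type (u + 1) where
  /-- the length of the sequence -/
  len : Ordinal.{u}
  /-- the entries of the sequence; only those at places `i < len` are meaningful -/
  val : Ordinal.{u} → Ordinal.{u}
  val_eq_zero : ∀ i, len ≤ i → val i = 0

namespace OrdSeq

/-- The empty sequence. -/
def empty : OrdSeq.{u} where
  len := 0
  val _ := 0
  val_eq_zero _ _ := rfl

open Classical in
/-- The restriction `η ↾ α` of a sequence to the ordinals below `α`. -/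
noncomputable def restrict (η : OrdSeq.{u}) (α : Ordinal.{u}) : OrdSeq.{u} where
  len := min η.len α
  val i := if i < α then η.val i else 0
  val_eq_zero i hi := by
    by_cases h : i < α
    · rw [if_pos h]
      rcases min_le_iff.1 hi with h' | h'
      · exact η.val_eq_zero i h'
      · exact absurd h (not_lt.2 h')
    · rw [if_neg h]

open Classical in
/-- The concatenation of `η` with the one-term sequence `⟨ζ⟩`. -/
noncomputable def snoc (η : OrdSeq.{u}) (ζ : Ordinal.{u}) : OrdSeq.{u} where
  len := Order.succ η.len
  val i := if i = η.len then ζ else η.val i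
  val_eq_zero i hi := by
    have h : η.len < i := Order.succ_le_iff.1 hi
    rw [if_neg h.ne']
    exact η.val_eq_zero i h.le

/-- `η ◁ ν`: the sequence `η` is a proper initial segment of `ν`. -/
def IsProperInitSeg (η ν : OrdSeq.{u}) : Prop :=
  η.len < ν.len ∧ ν.restrict η.len = η

/-- The product `∏_{i < α} f(i)`, where an ordinal `f(i)` is identified with the set of
smaller ordinals. -/
def prod (f : Ordinal.{u} → Ordinal.{u}) (α : Ordinal.{u}) : Set OrdSeq.{u} :=
  {η | η.len = α ∧ ∀ i < α, η.val i < f i}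

/-- The set of all sequences of length less than `δ` of ordinals less than `δ`. -/
def seqsBelow (δ : Ordinal.{u}) : Set OrdSeq.{u} :=
  {η | η.len < δ ∧ ∀ i < η.len, η.val i < δ}

/-- The set of all `ζ` such that `η` followed by `ζ` is in `T`. -/
def suc (T : Set OrdSeq.{u}) (η : OrdSeq.{u}) : Set Ordinal.{u} :=
  {ζ | η.snoc ζ ∈ T}

/-- `η` has exactly one immediate successor in `T`. -/
def SucIsSingleton (T : Set OrdSeq.{u}) (η : OrdSeq.{u}) : Prop :=
  ∃ ζ, suc T η = {ζ}

/-- The set of `δ`-branches of `T`: the sequences of length `δ` all of whose restrictions to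
ordinals below `δ` are in `T`. -/
def lim (δ : Ordinal.{u}) (T : Set OrdSeq.{u}) : Set OrdSeq.{u} :=
  {η | η.len = δ ∧ ∀ α < δ, η.restrict α ∈ T}

end OrdSeq

/-- A filter `D` on a set is `(κ, θ)`-regular: there are `A_α ∈ D` for `α < κ` such that each point
is in fewer than `θ` of the sets `A_α`. -/
def IsRegularFilter {δ : Ordinal.{u}} (D : Filter (Iio δ)) (κ θ : Cardinal.{u}) : Prop :=
  ∃ A : Iio κ.ord → Set (Iio δ), (∀ α, A α ∈ D) ∧
    ∀ i, #{α | i ∈ A α} < Cardinal.lift.{u + 1} θ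

/-- `T` is a `δ`-special tree. -/
structure IsSpecialTree (δ : Ordinal.{u}) (T : Set OrdSeq.{u}) : Prop where
  subset : T ⊆ OrdSeq.seqsBelow δ
  no_maximal : ∀ η ∈ T, ∃ ν ∈ T, η.IsProperInitSeg ν
  empty_mem : OrdSeq.empty ∈ T
  restrict_mem : ∀ η ∈ T, ∀ α < η.len, η.restrict α ∈ T
  closed : ∀ η ∈ OrdSeq.seqsBelow δ,
    (∀ α < η.len, η.restrict (Order.succ α) ∈ T) → η ∈ T

/-- `(D, T)` is a `(δ, κ, θ)`-special pair. -/
structure IsSpecialPair (δ : Ordinal.{u}) (κ θ : Cardinal.{u}) (D : Filter (Iio δ))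
    (T : Set OrdSeq.{u}) : Prop where
  theta_le : θ ≤ κ
  theta_regular : θ.IsRegular
  limit : Order.IsSuccLimit δ
  le_delta : κ.ord ≤ δ
  regular : IsRegularFilter D κ θ
  tree : IsSpecialTree δ T
  branch : ∀ η ∈ OrdSeq.lim δ T,
    {α : Iio δ | ¬ OrdSeq.SucIsSingleton T (η.restrict α)} ∈ D

/-- `T` is a `∂`-lean tree of sequences of length `< δ`. -/
structure IsLeanTree (δ : Ordinal.{u}) (c : Cardinal.{u}) (T : Set OrdSeq.{u}) : Prop where
  tree : IsSpecialTree δ T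
  lean : ∀ α < δ,
    #{η | η ∈ T ∧ η.len = α ∧ ¬ OrdSeq.SucIsSingleton T η} < Cardinal.lift.{u + 1} c

/-- `F` is a witness that the values of the functions in `∏_{i < μ} f(i)` below `α` are guessed,
for `D`-many `α`, with fewer than `θ` guesses. Only the sets `F α` with `α ∈ S` matter. -/
structure IsGuessingWitness (μ : Cardinal.{u}) (S : Set (Iio μ.ord)) (θ : Cardinal.{u})
    (f : Ordinal.{u} → Ordinal.{u}) (D : Filter (Iio μ.ord))
    (F : Iio μ.ord → Set OrdSeq.{u}) : Prop where
  subset : ∀ α ∈ S, F α ⊆ OrdSeq.prod f α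
  card_lt : ∀ α ∈ S, #(F α) < Cardinal.lift.{u + 1} θ
  guess : ∀ g ∈ OrdSeq.prod f μ.ord, {α : Iio μ.ord | α ∈ S ∧ g.restrict α ∈ F α} ∈ D

/-- `D` is a `(μ, S, κ, θ, f)`-1-special filter. Only the values `f i` with `i < μ` matter. -/
structure IsOneSpecialFilter (μ : Cardinal.{u}) (S : Set (Iio μ.ord)) (κ θ : Cardinal.{u})
    (f : Ordinal.{u} → Ordinal.{u}) (D : Filter (Iio μ.ord)) : Prop where
  uncountable : ℵ₀ < μ
  card_S : #S = Cardinal.lift.{u + 1} μ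
  regular : IsRegularFilter D κ θ
  theta_le : θ ≤ κ
  theta_regular : θ.IsRegular
  uniform : ∀ A ∈ D, #A = Cardinal.lift.{u + 1} μ
  cobounded : ∀ β : Iio μ.ord, Ici β ∈ D
  S_mem : S ∈ D
  complete : CardinalInterFilter D (Cardinal.lift.{u + 1} θ)
  f_range : ∀ i < μ.ord, 0 < f i ∧ f i < μ.ord
  witness : ∃ F, IsGuessingWitness μ S θ f D F

/-- `(D, T)` is a `(μ, S, κ, θ, f)`-2-special pair. Only the values `f i` with `i < μ` matter. -/
structure IsTwoSpecialPair (μ : Cardinal.{u}) (S : Set (Iio μ.ord)) (κ θ : Cardinal.{u})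
    (f : Ordinal.{u} → Ordinal.{u}) (D : Filter (Iio μ.ord)) (T : Set OrdSeq.{u}) : Prop where
  kappa_le : κ ≤ μ
  theta_lt : θ < κ
  theta_regular : θ.IsRegular
  sup_S : IsLUB (Subtype.val '' S) μ.ord
  f_range : ∀ i < μ.ord, f i < Order.succ μ.ord
  oneSpecial : IsOneSpecialFilter μ S κ θ f D
  complete : CardinalInterFilter D (Cardinal.lift.{u + 1} θ)
  S_mem : S ∈ D
  subset_prod : ∀ η ∈ T, η.len < μ.ord ∧ η ∈ OrdSeq.prod f η.len
  card_le : #T ≤ Cardinal.lift.{u + 1} μ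
  lean : IsLeanTree μ.ord θ T
  special : IsSpecialPair μ.ord κ θ D T
  full : ∀ η ∈ T, ¬ OrdSeq.SucIsSingleton T η → OrdSeq.suc T η = Iio (f η.len)

/-- The diamond principle `◇_μ`: there are sets `A_δ` for `δ < μ` such that for every `X ⊆ μ` the
set of all `δ < μ` with `X ∩ δ = A_δ` is stationary in `μ`. -/
def DiamondPrinciple (μ : Cardinal.{u}) : Prop :=
  ∃ A : Iio μ.ord → Set (Iio μ.ord), ∀ X : Set (Iio μ.ord),
    IsStationary {δ | X ∩ Iio δ = A δ}

/-!
Everything rests on one guessing principle, `GuessesBelow κ⁺ E`: a fixed family of predictions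
`P δ : δ → E` (`δ < κ⁺`) is right about every function `h : κ⁺ → E` at unboundedly many `δ`.
This unbounded form of Jensen's diamond is available for

* uncountable `κ` with `2 ^ κ = κ⁺`, by Shelah's theorem (`guessesBelow_succ`). Code functions
  `κ × κ × α → E` with `α < κ⁺` by ordinals below `κ⁺`. If guessing failed, one could choose by
  recursion, for `i, τ < κ`, a function `Z i τ` that defeats the guess read off at `δ` from those
  codes which a fixed injection of `δ` into `κ` maps below `i` and which agree with all `Z i ε`,
  `ε < τ`. A single sequence of codes describes all restrictions `Z i τ ↾ α`.
  At a suitable `δ`, of cofinality different from that of `κ`, some `i < κ` catches cofinally many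
  members of this sequence (`exists_lt_succ_unbounded`); each of the `κ` defeats then eliminates
  one of fewer than `κ` codes, a contradiction;
* `κ = ℵ₀` under `◇_{ℵ₁}`, by coding functions by subsets of `ℵ₁`
  (`guessesBelow_of_diamondPrinciple`).

Taking lists for the values of `h`, one guesses finitely many functions into `σ` and finitely many
ordinals at once. Using the guesses for `κ = |α|` at `α < μ` gives finite sets `F α` of sequences
and `w α` of ordinals, and any finitely many functions and ordinals are simultaneously guessed at
`μ` many `α` (`exists_finite_guesses_card`); limit cardinals `μ`, regular or singular, need no
separate argument, since the relevant `κ` are unbounded in `μ`. Hence the sets where a function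
is guessed by `F`, the sets where an ordinal is guessed by `w`, and the final segments of `μ`
generate a uniform filter `D`. The finiteness of the `w α` makes it `(μ, ℵ₀)`-regular, and the `F α`
witness that it is 1-special.

For the second part let a node `η` of length `α` split fully if `η ∈ F α`, and extend it only by
`0` otherwise (`OrdSeq.splittingTree`). This tree is lean because the `F α` are finite, it has at
most `μ` nodes by cardinal arithmetic, and each branch splits at `D`-many levels because `F` guesses
it.
-/

universe v

/-! ### Ordinal preliminaries -/

theorem exists_lt_forall_le_of_lt_cof {ι : Type v} {a : Ordinal.{u}} (f : ι → Ordinal.{u})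
    (hι : Cardinal.lift.{u} #ι < Cardinal.lift.{v} a.cof) (hf : ∀ i, f i < a) :
    ∃ b < a, ∀ i, f i ≤ b :=
  ⟨⨆ i, f i, Ordinal.lift_iSup_lt_of_lt_cof (by rwa [← Ordinal.lift_cof]) hf,
    le_ciSup (f := f) ⟨a, by rintro _ ⟨i, rfl⟩; exact (hf i).le⟩⟩

/-- The case of `exists_lt_forall_le_of_lt_cof` for families indexed by the ordinals below `o`. -/
theorem exists_lt_forall_lt_le_of_lt_cof {o a : Ordinal.{u}} (f : Ordinal.{u} → Ordinal.{u})
    (ho : o.card < a.cof) (hf : ∀ i < o, f i < a) : ∃ b < a, ∀ i < o, f i ≤ b := by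
  obtain ⟨b, hb, h⟩ := exists_lt_forall_le_of_lt_cof (a := a) (fun i : Iio o => f i)
    (by rw [Cardinal.mk_Iio_ordinal, Cardinal.lift_lift]; exact Cardinal.lift_lt.2 ho)
    fun i => hf i i.2
  exact ⟨b, hb, fun i hi => h ⟨i, hi⟩⟩

theorem cof_ord_succ {κ : Cardinal.{u}} (hκ : ℵ₀ ≤ κ) :
    (Order.succ κ).ord.cof = Order.succ κ :=
  (isRegular_succ hκ).cof_ord

/-- Either `ℵ₀` or `ℵ₁` differs from the cofinality of `κ`, and functions from such a regular
cardinal to `κ` are bounded on an unbounded set. -/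
theorem exists_regular_forall_bounded_unboundedly {κ : Cardinal.{u}} (hκ : ℵ₀ < κ) :
    ∃ ν : Cardinal.{u}, ν.IsRegular ∧ ν ≤ κ ∧ ∀ h : Ordinal.{u} → Ordinal.{u},
      (∀ o < ν.ord, h o < κ.ord) →
        ∃ i < κ.ord, ∀ γ < ν.ord, ∃ o, γ ≤ o ∧ o < ν.ord ∧ h o < i := by
  have hlim : Order.IsSuccLimit κ.ord := isSuccLimit_ord hκ.le
  have hcof : ℵ₀ ≤ κ.ord.cof := Ordinal.aleph0_le_cof_iff.2 (Ordinal.one_lt_cof_iff.2 hlim)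
  rcases hcof.eq_or_lt with hc | hc
  · refine ⟨ℵ₁, isRegular_aleph_one, ?_, fun h hh => ?_⟩
    · rw [← succ_aleph0]; exact Order.succ_le_of_lt hκ
    · obtain ⟨s, hs, hsc⟩ := Order.exists_cof_eq (α := Iio κ.ord)
      rw [Ordinal.cof_Iio, ← Ordinal.lift_cof, ← hc, Cardinal.lift_aleph0] at hsc
      have : Countable s := by rw [← Cardinal.mk_le_aleph0_iff, hsc]
      by_contra! H
      choose γ hγ hγh using H
      -- Otherwise the bounds coming from a countable cofinal set of values have a common bound.
      obtain ⟨b, hb, hbγ⟩ := exists_lt_forall_le_of_lt_cof (a := (ℵ₁ : Cardinal.{u}).ord)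
        (fun i : s => γ i.1.1 i.1.2)
        (by
          rw [isRegular_aleph_one.cof_ord, hsc, Cardinal.lift_aleph0, Cardinal.lift_aleph]
          simp) fun i => hγ _ _
      obtain ⟨j, hj, hij⟩ := hs ⟨Order.succ (h b), hlim.succ_lt (hh b hb)⟩
      have := hγh j.1 j.2 b (hbγ ⟨j, hj⟩) hb
      have h2 : Order.succ (h b) ≤ j.1 := hij
      exact absurd (Order.succ_le_iff.1 h2) (not_lt.2 this)
  · refine ⟨ℵ₀, isRegular_aleph0, hκ.le, fun h hh => ?_⟩
    obtain ⟨b, hb, H⟩ := exists_lt_forall_lt_le_of_lt_cof (o := (ℵ₀ : Cardinal.{u}).ord) h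
      (by simpa using hc) hh
    exact ⟨Order.succ b, hlim.succ_lt hb,
      fun γ hγ => ⟨γ, le_rfl, hγ, Order.lt_succ_iff.2 (H γ hγ)⟩⟩

/-- The sequence obtained by iterating `g` transfinitely, taking suprema at limits. -/
noncomputable def iterSup (g : Ordinal.{u} → Ordinal.{u}) (o : Ordinal.{u}) : Ordinal.{u} :=
  ⨆ p : Iio o, g (iterSup g p)
termination_by o
decreasing_by exact p.2

theorem apply_iterSup_le (g : Ordinal.{u} → Ordinal.{u}) {p o : Ordinal.{u}} (h : p < o) :
    g (iterSup g p) ≤ iterSup g o := by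
  rw [iterSup.eq_1 g o]
  exact Ordinal.le_iSup (fun p : Iio o => g (iterSup g p)) ⟨p, h⟩

theorem exists_lt_apply_iterSup (g : Ordinal.{u} → Ordinal.{u}) {x o : Ordinal.{u}}
    (h : x < iterSup g o) : ∃ p < o, x < g (iterSup g p) := by
  rw [iterSup.eq_1, Ordinal.lt_iSup_iff] at h
  obtain ⟨p, hp⟩ := h
  exact ⟨p, p.2, hp⟩

theorem iterSup_lt {g : Ordinal.{u} → Ordinal.{u}} {a o : Ordinal.{u}} (hg : ∀ x < a, g x < a)
    (ho : o.card < a.cof) : iterSup g o < a := by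
  induction o using WellFoundedLT.induction with
  | ind o ih =>
    rw [iterSup.eq_1]
    refine Ordinal.lift_iSup_lt_of_lt_cof ?_ fun p =>
      hg _ (ih p p.2 ((Ordinal.card_le_card p.2.le).trans_lt ho))
    rw [← Ordinal.lift_cof, Cardinal.mk_Iio_ordinal, Cardinal.lift_lift]
    exact Cardinal.lift_lt.2 ho

/-- Some `δ < κ⁺` has cofinally many `α < δ` such that `ρ α < δ` and the values `e δ (ρ α)` have a
common bound below `κ`: the cofinality of `δ` is chosen different from that of `κ`. -/
theorem exists_lt_succ_unbounded {κ : Cardinal.{u}} (hκ : ℵ₀ < κ)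
    {ρ : Ordinal.{u} → Ordinal.{u}}
    (hρ : ∀ α < (Order.succ κ).ord, ρ α < (Order.succ κ).ord)
    {e : Ordinal.{u} → Ordinal.{u} → Ordinal.{u}}
    (he : ∀ δ < (Order.succ κ).ord, ∀ a < δ, e δ a < κ.ord)
    {b : Ordinal.{u}} (hb : b < (Order.succ κ).ord) :
    ∃ δ, b < δ ∧ δ < (Order.succ κ).ord ∧ ∃ i < κ.ord,
      ∀ γ < δ, ∃ α, γ < α ∧ α < δ ∧ ρ α < δ ∧ e δ (ρ α) < i := by
  obtain ⟨ν, hν, hνκ, H⟩ := exists_regular_forall_bounded_unboundedly hκ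
  have hΛ : Order.IsSuccLimit (Order.succ κ).ord :=
    isSuccLimit_ord (hκ.le.trans (Order.le_succ κ))
  have hνlim : Order.IsSuccLimit ν.ord := isSuccLimit_ord hν.aleph0_le
  set g : Ordinal.{u} → Ordinal.{u} := fun x => Order.succ (max x (max (ρ x) b)) with hg
  have hgx : ∀ x, x < g x := fun x => Order.lt_succ_iff.2 (le_max_left _ _)
  have hgρ : ∀ x, ρ x < g x := fun x =>
    Order.lt_succ_iff.2 ((le_max_left _ _).trans (le_max_right _ _))
  have hgb : ∀ x, b < g x := fun x =>
    Order.lt_succ_iff.2 ((le_max_right _ _).trans (le_max_right _ _))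
  have hlt : ∀ {p o}, p < o → iterSup g p < iterSup g o := fun h =>
    (hgx _).trans_le (apply_iterSup_le g h)
  have hδ : iterSup g ν.ord < (Order.succ κ).ord := by
    refine iterSup_lt (fun x hx => hΛ.succ_lt (max_lt hx (max_lt (hρ x hx) hb))) ?_
    rw [card_ord, cof_ord_succ hκ.le]; exact Order.lt_succ_iff.2 hνκ
  have hρδ : ∀ o < ν.ord, ρ (iterSup g o) < iterSup g ν.ord := fun o ho =>
    (hgρ _).trans_le (apply_iterSup_le g ho)
  obtain ⟨i, hi, hiu⟩ := H (fun o => e (iterSup g ν.ord) (ρ (iterSup g o)))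
    fun o ho => he _ hδ _ (hρδ o ho)
  refine ⟨iterSup g ν.ord, (hgb _).trans_le (apply_iterSup_le g hν.ord_pos), hδ, i, hi,
    fun γ hγ => ?_⟩
  obtain ⟨p, hp, hγp⟩ := exists_lt_apply_iterSup g hγ
  obtain ⟨o, hpo, ho, hoi⟩ := hiu (Order.succ p) (hνlim.succ_lt hp)
  exact ⟨iterSup g o, hγp.trans_le (apply_iterSup_le g (Order.succ_le_iff.1 hpo)), hlt ho,
    hρδ o ho, hoi⟩

/-- Definition by well-founded recursion, where `Φ τ Z` depends only on the restriction of `Z`. -/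
theorem exists_wellFounded_solution {I : Type*} [LinearOrder I] [WellFoundedLT I] {X : Type*}
    [Nonempty X] (Φ : I → (I → X) → X)
    (hΦ : ∀ τ Z Z', (∀ ε < τ, Z ε = Z' ε) → Φ τ Z = Φ τ Z') : ∃ Z, ∀ τ, Z τ = Φ τ Z := by
  classical
  let F : ∀ τ : I, (∀ ε, ε < τ → X) → X := fun τ r =>
    Φ τ fun ε => if h : ε < τ then r ε h else Classical.arbitrary X
  refine ⟨IsWellFounded.fix (· < ·) F, fun τ => ?_⟩
  rw [IsWellFounded.fix_eq]
  exact hΦ _ _ _ fun ε hε => by simp [hε]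

theorem power_le_two_power {x y K : Cardinal.{v}} (hK : ℵ₀ ≤ K) (hx : x ≤ 2 ^ K) (hy : y ≤ K) :
    x ^ y ≤ 2 ^ K :=
  calc x ^ y ≤ (2 ^ K) ^ y := power_le_power_right hx
    _ = 2 ^ (K * y) := (power_mul ..).symm
    _ ≤ 2 ^ K := power_le_power_left two_ne_zero
      ((mul_le_mul_right hy K).trans (mul_eq_self hK).le)

theorem mk_Iio_ord (κ : Cardinal.{u}) : #(Iio κ.ord) = Cardinal.lift.{u + 1} κ := by
  rw [Cardinal.mk_Iio_ordinal, card_ord]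

theorem mk_sigma_functions_le {κ : Cardinal.{u}} (hκ : ℵ₀ ≤ κ) (h2 : 2 ^ κ = Order.succ κ)
    {E : Type (u + 1)} (hE : #E ≤ Cardinal.lift.{u + 1} (Order.succ κ)) :
    #(Σ α : Iio (Order.succ κ).ord, (Iio κ.ord → Iio κ.ord → Iio α.1 → E)) ≤
      Cardinal.lift.{u + 1} (Order.succ κ) := by
  rw [← h2, Cardinal.lift_two_power] at hE ⊢
  have hK : ℵ₀ ≤ Cardinal.lift.{u + 1} κ := by simpa using hκ
  rw [Cardinal.mk_sigma]
  have hle : ∀ α : Iio ((2 : Cardinal.{u}) ^ κ).ord,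
      #(Iio κ.ord → Iio κ.ord → Iio α.1 → E) ≤ 2 ^ Cardinal.lift.{u + 1} κ := fun α => by
    rw [← power_def, ← power_def, ← power_def]
    refine power_le_two_power hK (power_le_two_power hK (power_le_two_power hK hE ?_)
      (mk_Iio_ord κ).le) (mk_Iio_ord κ).le
    rw [Cardinal.mk_Iio_ordinal, Cardinal.lift_le]
    exact Order.lt_succ_iff.1 (h2 ▸ lt_ord.1 (mem_Iio.1 α.2))
  refine (Cardinal.sum_le_sum _ _ hle).trans ?_
  rw [Cardinal.sum_const', mk_Iio_ord, Cardinal.lift_two_power]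
  exact (mul_eq_self (hK.trans (cantor _).le)).le

/-- Every ordinal below `κ⁺` injects into `κ`. -/
theorem exists_injOn_Iio_lt_ord (κ : Cardinal.{u}) :
    ∃ e : Ordinal.{u} → Ordinal.{u} → Ordinal.{u}, ∀ δ < (Order.succ κ).ord,
      (∀ a < δ, e δ a < κ.ord) ∧ InjOn (e δ) (Iio δ) := by
  have H : ∀ δ : Ordinal.{u}, ∃ e : Ordinal.{u} → Ordinal.{u}, δ < (Order.succ κ).ord →
      (∀ a < δ, e a < κ.ord) ∧ InjOn e (Iio δ) := fun δ => by
    by_cases hδ : δ < (Order.succ κ).ord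
    · have hc : #(Iio δ) ≤ #(Iio κ.ord) := by
        rw [Cardinal.mk_Iio_ordinal, mk_Iio_ord, Cardinal.lift_le]
        exact Order.lt_succ_iff.1 (lt_ord.1 hδ)
      obtain ⟨j⟩ := hc
      refine ⟨fun a => if h : a ∈ Iio δ then j ⟨a, h⟩ else 0, fun _ => ⟨fun a ha => ?_, ?_⟩⟩
      · simp only [dif_pos (mem_Iio.2 ha)]; exact (j ⟨a, ha⟩).2
      · intro a ha a' ha' h
        simp only [dif_pos ha, dif_pos ha'] at h
        exact congrArg Subtype.val (j.injective (Subtype.ext h))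
    · exact ⟨id, fun h => absurd h hδ⟩
  choose e he using H
  exact ⟨e, he⟩

/-! ### Guessing principles -/

/-- Below `μ`, arbitrarily long initial segments of any function on the ordinals with values in `E`
are predicted: `P δ` is the prediction of the restriction to the ordinals below `δ`. -/
def GuessesBelow (μ : Cardinal.{u}) (E : Type v) : Prop :=
  ∃ P : Ordinal.{u} → Ordinal.{u} → E, ∀ h : Ordinal.{u} → E, ∀ β < μ.ord,
    ∃ δ, β < δ ∧ δ < μ.ord ∧ ∀ i < δ, h i = P δ i

/-- Shelah's theorem that `2 ^ κ = κ⁺` implies the diamond principle at `κ⁺` for uncountable `κ`, in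
its version for unbounded instead of stationary sets. -/
theorem guessesBelow_succ {κ : Cardinal.{u}} (hκ : ℵ₀ < κ) (h2 : 2 ^ κ = Order.succ κ)
    {E : Type (u + 1)} [Nonempty E] (hE : #E ≤ Cardinal.lift.{u + 1} (Order.succ κ)) :
    GuessesBelow (Order.succ κ) E := by
  classical
  set Λ := (Order.succ κ).ord with hΛ
  obtain ⟨e, he⟩ := exists_injOn_Iio_lt_ord κ
  let C := Σ α : Iio Λ, (Iio κ.ord → Iio κ.ord → Iio α.1 → E)
  have hC : #C ≤ #(Iio Λ) := by
    rw [mk_Iio_ord]; exact mk_sigma_functions_le hκ.le h2 hE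
  obtain ⟨rank⟩ := hC
  -- The codes seen by `i` at `δ` that agree with `Z` on the coordinates below `τ`, and the guess
  -- that they suggest for the coordinate `τ`.
  let V (i : Iio κ.ord) (δ : Ordinal.{u}) (Z : Iio κ.ord → Ordinal.{u} → E) (τ : Iio κ.ord) :
      Set C := {c | (rank c).1 < δ ∧ e δ (rank c) < i ∧
        ∀ ε < τ, ∀ ξ (h : ξ ∈ Iio c.1.1), c.2 i ε ⟨ξ, h⟩ = Z ε ξ}
  let P (i : Iio κ.ord) (Z : Iio κ.ord → Ordinal.{u} → E) (τ : Iio κ.ord)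
      (δ ξ : Ordinal.{u}) : E :=
    Classical.epsilon fun x => ∃ c ∈ V i δ Z τ, ∃ h : ξ ∈ Iio c.1.1, c.2 i τ ⟨ξ, h⟩ = x
  by_contra hno
  unfold GuessesBelow at hno
  push Not at hno
  choose H B hB hbad using hno
  have hZ : ∀ i, ∃ Z : Iio κ.ord → Ordinal.{u} → E, ∀ τ, Z τ = H (P i Z τ) := fun i => by
    refine exists_wellFounded_solution (fun τ Z => H (P i Z τ)) fun τ Z Z' hZZ' => ?_
    have : ∀ δ, V i δ Z τ = V i δ Z' τ := fun δ => by
      ext c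
      simp only [V, mem_ofPred_eq]
      refine and_congr_right fun _ => and_congr_right fun _ =>
        forall_congr' fun ε => forall_congr' fun hε => ?_
      rw [hZZ' ε hε]
    simp only [P, this]
  choose Z hZ using hZ
  -- One sequence of codes describes all the `Z i τ` together.
  let code (α : Ordinal.{u}) (h : α ∈ Iio Λ) : C := ⟨⟨α, h⟩, fun i τ ξ => Z i τ ξ⟩
  let ρ (α : Ordinal.{u}) : Ordinal.{u} := if h : α ∈ Iio Λ then rank (code α h) else 0
  have hρ : ∀ α < Λ, ρ α < Λ := fun α h => by
    simp only [ρ, dif_pos (mem_Iio.2 h)]; exact (rank (code α h)).2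
  obtain ⟨b, hb, hbB⟩ := exists_lt_forall_le_of_lt_cof (a := Λ)
    (fun p : Iio κ.ord × Iio κ.ord => B (P p.1 (Z p.1) p.2))
    (by
      rw [hΛ, cof_ord_succ hκ.le, Cardinal.mk_prod, mk_Iio_ord, Cardinal.lift_id,
        mul_eq_self (by simpa using hκ.le), Cardinal.lift_lift, Cardinal.lift_lt]
      exact Order.lt_succ κ) fun p => hB _
  obtain ⟨δ, hbδ, hδ, i₀, hi, hu⟩ := exists_lt_succ_unbounded hκ hρ (fun δ h => (he δ h).1) hb
  let i : Iio κ.ord := ⟨i₀, hi⟩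
  -- Whenever the guess with index `(i, τ)` fails at `δ`, it was read off from a wrong code `c τ`,
  -- which no longer occurs after stage `τ`.
  have hex : ∀ τ, ∃ c : C, c ∈ V i δ (Z i) τ ∧
      ∃ ξ, ∃ h : ξ ∈ Iio c.1.1, c.2 i τ ⟨ξ, h⟩ ≠ Z i τ ξ := by
    intro τ
    obtain ⟨ξ, hξ, hne⟩ := hbad (P i (Z i) τ) δ ((hbB (i, τ)).trans_lt hbδ) hδ
    rw [← hZ i τ] at hne
    obtain ⟨α, hα, hαδ, hρα, heα⟩ := hu ξ hξ
    have hαΛ : α ∈ Iio Λ := hαδ.trans hδ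
    simp only [ρ, dif_pos hαΛ] at hρα heα
    obtain ⟨c, hc, h, hx⟩ := Classical.epsilon_spec
      (p := fun x => ∃ c ∈ V i δ (Z i) τ, ∃ h : ξ ∈ Iio c.1.1, c.2 i τ ⟨ξ, h⟩ = x)
      ⟨_, code α hαΛ, ⟨hρα, heα, fun _ _ _ _ => rfl⟩, hα, rfl⟩
    exact ⟨c, hc, ξ, h, fun heq => hne (heq.symm.trans hx)⟩
  choose c hcV ξ hξ hne using hex
  have hinj : Function.Injective fun τ => (⟨e δ (rank (c τ)), (hcV τ).2.1⟩ : Iio i₀) := by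
    intro τ τ' h
    have hcc : c τ = c τ' := rank.injective (Subtype.ext
      ((he δ hδ).2 (hcV τ).1 (hcV τ').1 (congrArg Subtype.val h)))
    by_contra hττ
    rcases lt_or_gt_of_ne hττ with hlt | hlt
    · have := (hcV τ').2.2 τ hlt
      rw [← hcc] at this
      exact hne τ (this _ (hξ τ))
    · have := (hcV τ).2.2 τ' hlt
      rw [hcc] at this
      exact hne τ' (this _ (hξ τ'))
  have := mk_le_of_injective hinj
  rw [mk_Iio_ord, Cardinal.mk_Iio_ordinal, Cardinal.lift_le] at this
  exact absurd (lt_ord.1 hi) (not_lt.2 this)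

/-- A function `h` is coded by the set of the codes of the pairs `(h i, i)`; on the club of the
`δ` closed under the coding, the part of this set below `δ` determines `h` below `δ`. -/
theorem guessesBelow_of_diamondPrinciple {μ : Cardinal.{u}} (hμ : μ.IsRegular) (hμ0 : ℵ₀ < μ)
    (hd : DiamondPrinciple μ) {E : Type (u + 1)} [Nonempty E]
    (hE : #E ≤ Cardinal.lift.{u + 1} μ) : GuessesBelow μ E := by
  classical
  have hlim : Order.IsSuccLimit μ.ord := isSuccLimit_ord hμ0.le
  obtain ⟨A, hA⟩ := hd
  have hcard : #(E × Iio μ.ord) ≤ #(Iio μ.ord) := by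
    rw [Cardinal.mk_prod, mk_Iio_ord, Cardinal.lift_id, Cardinal.lift_id]
    exact (mul_le_mul_left hE _).trans (mul_eq_self (by simpa using hμ0.le)).le
  obtain ⟨π⟩ := hcard
  refine ⟨fun δ i => Classical.epsilon fun x => ∃ (hδ : δ ∈ Iio μ.ord) (hi : i ∈ Iio μ.ord),
    π (x, ⟨i, hi⟩) ∈ A ⟨δ, hδ⟩, fun h β hβ => ?_⟩
  let code (i : Iio μ.ord) : Iio μ.ord := π (h i, i)
  have hclub : IsClub {δ : Iio μ.ord | β < δ ∧ ∀ i < δ, code i < δ} := by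
    refine ⟨fun d hd hne _ a ha => ?_, fun a => ?_⟩
    · obtain ⟨x, hx⟩ := hne
      refine ⟨(hd hx).1.trans_le (ha.1 hx), fun i hi => ?_⟩
      obtain ⟨y, hy, hiy⟩ := (lt_isLUB_iff ha).1 hi
      exact ((hd hy).2 i hiy).trans_le (ha.1 hy)
    -- Cofinality: iterate `ω` times a function that dominates the codes of all smaller ordinals.
    · let ρ (x : Ordinal.{u}) : Ordinal.{u} := if hx : x ∈ Iio μ.ord then code ⟨x, hx⟩ else 0
      let s (x : Ordinal.{u}) : Ordinal.{u} :=
        Order.succ (max x (max (⨆ y : Iio x, ρ y) (max β a)))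
      have hs : ∀ x < μ.ord, s x < μ.ord := by
        intro x hx
        refine hlim.succ_lt (max_lt hx (max_lt ?_ (max_lt hβ a.2)))
        refine Ordinal.lift_iSup_lt_of_lt_cof ?_ fun y => ?_
        · rw [← Ordinal.lift_cof, Cardinal.mk_Iio_ordinal, Cardinal.lift_lift, hμ.cof_ord]
          exact Cardinal.lift_lt.2 (lt_ord.1 hx)
        · simp only [ρ, dif_pos (mem_Iio.2 ((mem_Iio.1 y.2).trans hx))]
          exact (code _).2
      have hlt : iterSup s (ℵ₀ : Cardinal.{u}).ord < μ.ord :=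
        iterSup_lt hs (by rwa [card_ord, hμ.cof_ord])
      have h0 : s (iterSup s 0) ≤ iterSup s (ℵ₀ : Cardinal.{u}).ord :=
        apply_iterSup_le s (by simp)
      refine ⟨⟨_, hlt⟩, ⟨lt_of_lt_of_le ?_ h0, fun i hi => ?_⟩, ?_⟩
      · exact Order.lt_succ_iff.2
          ((le_max_left _ _).trans ((le_max_right _ _).trans (le_max_right _ _)))
      · obtain ⟨p, hp, hip⟩ := exists_lt_apply_iterSup s (Subtype.coe_lt_coe.2 hi)
        have hp' : Order.succ p < (ℵ₀ : Cardinal.{u}).ord :=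
          (isSuccLimit_ord le_rfl).succ_lt hp
        have h1 : i.1 < iterSup s (Order.succ p) :=
          hip.trans_le (apply_iterSup_le s (Order.lt_succ p))
        refine Subtype.coe_lt_coe.1 (lt_of_lt_of_le ?_ (apply_iterSup_le s hp'))
        refine Order.lt_succ_iff.2 (le_trans ?_ ((le_max_left _ _).trans (le_max_right _ _)))
        have := Ordinal.le_iSup (fun y : Iio (iterSup s (Order.succ p)) => ρ y) ⟨i, h1⟩
        simpa only [ρ, dif_pos i.2] using this
      · refine Subtype.coe_le_coe.1 (le_trans ?_ h0)
        exact (Order.lt_succ_iff.2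
          ((le_max_right _ _).trans ((le_max_right _ _).trans (le_max_right _ _)))).le
  obtain ⟨δ, hδA, hβδ, hδ⟩ := hA (range code) hclub
  refine ⟨δ, hβδ, δ.2, fun i hi => ?_⟩
  have hiμ : i ∈ Iio μ.ord := hi.trans δ.2
  have hδA' : range code ∩ Iio δ = A δ := hδA
  obtain ⟨hδ₁, hi₁, hx⟩ := Classical.epsilon_spec
    (p := fun x => ∃ (hδ : δ.1 ∈ Iio μ.ord) (hi : i ∈ Iio μ.ord), π (x, ⟨i, hi⟩) ∈ A ⟨δ.1, hδ⟩)
    ⟨h i, δ.2, hiμ, (Set.ext_iff.1 hδA' _).1 ⟨⟨⟨i, hiμ⟩, rfl⟩, hδ ⟨i, hiμ⟩ hi⟩⟩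
  obtain ⟨⟨j, hj⟩, -⟩ := (Set.ext_iff.1 hδA' _).2 hx
  have hji := Prod.mk.inj (π.injective hj)
  exact (congrArg (fun x : Iio μ.ord => h x) hji.2).symm.trans hji.1

/-! ### Finite guesses and the filter -/

/-- Finite sets `F α` of sequences and `w α` of ordinals that simultaneously guess, at
unboundedly many `α < κ⁺`, finitely many sequences bounded by `f` and finitely many ordinals. -/
theorem exists_finite_guesses {κ : Cardinal.{u}} (hκ : ℵ₀ ≤ κ)
    (hg : ∀ (E : Type (u + 1)) [Nonempty E], #E ≤ Cardinal.lift.{u + 1} (Order.succ κ) →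
      GuessesBelow (Order.succ κ) E)
    {f : Ordinal.{u} → Ordinal.{u}}
    (hf : ∀ i < (Order.succ κ).ord, f i ≤ (Order.succ κ).ord) :
    ∃ (F : Ordinal.{u} → Set OrdSeq.{u}) (w : Ordinal.{u} → Set Ordinal.{u}),
      (∀ α, (F α).Finite ∧ F α ⊆ OrdSeq.prod f α ∧ (w α).Finite) ∧
      ∀ G : List OrdSeq.{u}, (∀ g ∈ G, (Order.succ κ).ord ≤ g.len ∧
          ∀ i < (Order.succ κ).ord, g.val i < f i) →
        ∀ l : List Ordinal.{u}, (∀ x ∈ l, x < (Order.succ κ).ord) →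
          ∀ β < (Order.succ κ).ord, ∃ α, β < α ∧ α < (Order.succ κ).ord ∧
            (∀ g ∈ G, g.restrict α ∈ F α) ∧ ∀ x ∈ l, x ∈ w α := by
  classical
  set Λ := (Order.succ κ).ord with hΛ
  have hκ' : ℵ₀ ≤ Order.succ κ := hκ.trans (Order.le_succ κ)
  have hΛlim : Order.IsSuccLimit Λ := isSuccLimit_ord hκ'
  have hmk : #(Iio Λ) = Cardinal.lift.{u + 1} (Order.succ κ) := mk_Iio_ord _
  have hinf : ℵ₀ ≤ #(Iio Λ) := by rw [hmk]; exact Cardinal.aleph0_le_lift.2 hκ'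
  have : Infinite (Iio Λ) := Cardinal.infinite_iff.2 hinf
  obtain ⟨P, hP⟩ := hg (List (Iio Λ) × List (Iio Λ)) (by
    rw [Cardinal.mk_prod, Cardinal.lift_id, Cardinal.mk_list_eq_mk, mul_eq_self hinf, hmk])
  -- The guessed function lists the values of the sequences, and the ordinals.
  let c (x : Ordinal.{u}) : Iio Λ := if h : x ∈ Iio Λ then ⟨x, h⟩ else Classical.arbitrary _
  have hc : ∀ x < Λ, (c x).1 = x := fun x hx => by simp only [c, dif_pos (mem_Iio.2 hx)]
  let Q (α : Ordinal.{u}) (n : ℕ) : Set OrdSeq.{u} := {η | η ∈ OrdSeq.prod f α ∧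
    ∀ i < α, (P α i).1[n]?.map Subtype.val = some (η.val i)}
  refine ⟨fun α => ⋃ n ∈ Iio (P α 0).1.length, Q α n, fun α => {x | ∃ y ∈ (P α 0).2, y.1 = x},
    fun α => ⟨?_, ?_, ?_⟩, fun G hG l hl β hβ => ?_⟩
  · refine (finite_Iio _).biUnion fun n _ => Set.Subsingleton.finite ?_
    rintro η ⟨⟨hη, -⟩, hηv⟩ η' ⟨⟨hη', -⟩, hηv'⟩
    refine OrdSeq.ext (hη.trans hη'.symm) (funext fun i => ?_)
    rcases lt_or_ge i α with hi | hi
    · exact Option.some.inj ((hηv i hi).symm.trans (hηv' i hi))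
    · rw [η.val_eq_zero i (hη.le.trans hi), η'.val_eq_zero i (hη'.le.trans hi)]
  · exact iUnion₂_subset fun n _ η hη => hη.1
  · exact ((P α 0).2.toFinset.finite_toSet.image Subtype.val).subset
      (by rintro x ⟨y, hy, rfl⟩; exact ⟨y, by simpa using hy, rfl⟩)
  · obtain ⟨α, hβα, hα, hh⟩ := hP (fun i => (G.map fun g => c (g.val i), l.map c)) β hβ
    have h0 := hh 0 (bot_le.trans_lt hβα)
    refine ⟨α, hβα, hα, fun g hgG => ?_, fun x hx => ?_⟩
    · obtain ⟨n, hn, rfl⟩ := List.mem_iff_getElem.1 hgG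
      refine mem_iUnion₂.2 ⟨n, ?_, ⟨?_, fun i hi => ?_⟩, fun i hi => ?_⟩
      · rw [← h0]; simpa using hn
      · exact min_eq_right (hα.le.trans (hG _ hgG).1)
      · simpa [OrdSeq.restrict, hi] using (hG _ hgG).2 i (hi.trans hα)
      · have hlt := (hG _ hgG).2 i (hi.trans hα)
        rw [← hh i hi]
        simp [hn, OrdSeq.restrict, hi, hc _ (hlt.trans_le (hf i (hi.trans hα)))]
    · refine ⟨c x, ?_, hc x (hl x hx)⟩
      rw [← h0]
      exact List.mem_map_of_mem hx

/-- A set of ordinals which is unbounded in `κ⁺` has more than `κ` elements. -/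
theorem lift_lt_mk_of_unbounded {κ μ : Cardinal.{u}} (hκ : ℵ₀ ≤ κ) {S : Set (Iio μ.ord)}
    (hS : ∀ β < (Order.succ κ).ord, ∃ α ∈ S, β < α.1 ∧ α.1 < (Order.succ κ).ord) :
    Cardinal.lift.{u + 1} κ < #S := by
  by_contra! h
  obtain ⟨b, hb, H⟩ := exists_lt_forall_le_of_lt_cof (a := (Order.succ κ).ord)
    (fun x : {x : S // x.1.1 < (Order.succ κ).ord} => x.1.1.1)
    (by
      rw [cof_ord_succ hκ, Cardinal.lift_succ, Cardinal.lift_id'.{u, u + 1}, Order.lt_succ_iff]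
      exact (mk_subtype_le _).trans h) fun x => x.2
  obtain ⟨α, hαS, hbα, hα⟩ := hS b hb
  exact absurd (H ⟨⟨α, hαS⟩, hα⟩) (not_le.2 hbα)

section

variable {μ : Cardinal.{u}}

/-- There are arbitrarily large `κ < μ` with a guessing principle at `κ⁺`. For `μ = ℵ₁` it is
`κ = ℵ₀`; otherwise `κ` can be taken uncountable. -/
theorem exists_le_lt_guessesBelow_succ (hμ : ℵ₀ < μ)
    (hGCH : ∀ κ : Cardinal.{u}, ℵ₀ ≤ κ → κ < μ → (2 : Cardinal.{u}) ^ κ = Order.succ κ)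
    (hdiamond : μ = ℵ₁ → DiamondPrinciple μ) {ν : Cardinal.{u}} (hν : ν < μ) :
    ∃ κ, ℵ₀ ≤ κ ∧ ν ≤ κ ∧ κ < μ ∧ ∀ (E : Type (u + 1)) [Nonempty E],
      #E ≤ Cardinal.lift.{u + 1} (Order.succ κ) → GuessesBelow (Order.succ κ) E := by
  rcases eq_or_ne μ ℵ₁ with h | h
  · rw [← succ_aleph0] at h
    refine ⟨ℵ₀, le_rfl, ?_, hμ, fun E _ hE => ?_⟩
    · rw [h] at hν; exact Order.lt_succ_iff.1 hν
    · rw [← h] at hE ⊢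
      refine guessesBelow_of_diamondPrinciple ?_ hμ (hdiamond (h.trans succ_aleph0)) hE
      rw [h]; exact isRegular_succ le_rfl
  · have h1 : ℵ₁ < μ := lt_of_le_of_ne (by rw [← succ_aleph0]; exact Order.succ_le_of_lt hμ) h.symm
    have h01 : ℵ₀ < max ν ℵ₁ := aleph0_lt_aleph_one.trans_le (le_max_right _ _)
    exact ⟨max ν ℵ₁, h01.le, le_max_left _ _, max_lt hν h1, fun E _ hE =>
      guessesBelow_succ h01 (hGCH _ h01.le (max_lt hν h1)) hE⟩

/-- Finite sets `F α` of sequences and `w α` of ordinals (`α < μ`) such that any finitely many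
elements of `∏_{i < μ} f(i)` and finitely many ordinals are simultaneously guessed at `μ` many
places beyond any given one. -/
theorem exists_finite_guesses_card {σ : Ordinal.{u}} {f : Ordinal.{u} → Ordinal.{u}}
    (hμ : ℵ₀ < μ) (hσμ : σ < μ.ord) (hf : ∀ i < μ.ord, f i = σ)
    (hGCH : ∀ κ : Cardinal.{u}, ℵ₀ ≤ κ → κ < μ → (2 : Cardinal.{u}) ^ κ = Order.succ κ)
    (hdiamond : μ = ℵ₁ → DiamondPrinciple μ) :
    ∃ (F : Ordinal.{u} → Set OrdSeq.{u}) (w : Ordinal.{u} → Set Ordinal.{u}),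
      (∀ α, (F α).Finite ∧ F α ⊆ OrdSeq.prod f α ∧ (w α).Finite) ∧
      ∀ G : List OrdSeq.{u}, (∀ g ∈ G, g ∈ OrdSeq.prod f μ.ord) →
        ∀ l : List Ordinal.{u}, (∀ x ∈ l, x < μ.ord) → ∀ β < μ.ord,
          #{α : Iio μ.ord | β < α.1 ∧ (∀ g ∈ G, g.restrict α ∈ F α) ∧ ∀ x ∈ l, x ∈ w α} =
            Cardinal.lift.{u + 1} μ := by
  have H : ∀ κ : Cardinal.{u}, ∃ (F : Ordinal.{u} → Set OrdSeq.{u})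
      (w : Ordinal.{u} → Set Ordinal.{u}),
      (∀ α, (F α).Finite ∧ F α ⊆ OrdSeq.prod f α ∧ (w α).Finite) ∧
      (ℵ₀ ≤ κ → σ.card ≤ κ → κ < μ →
        (∀ (E : Type (u + 1)) [Nonempty E], #E ≤ Cardinal.lift.{u + 1} (Order.succ κ) →
          GuessesBelow (Order.succ κ) E) →
        ∀ G : List OrdSeq.{u}, (∀ g ∈ G, (Order.succ κ).ord ≤ g.len ∧
            ∀ i < (Order.succ κ).ord, g.val i < f i) →
          ∀ l : List Ordinal.{u}, (∀ x ∈ l, x < (Order.succ κ).ord) →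
            ∀ β < (Order.succ κ).ord, ∃ α, β < α ∧ α < (Order.succ κ).ord ∧
              (∀ g ∈ G, g.restrict α ∈ F α) ∧ ∀ x ∈ l, x ∈ w α) := by
    intro κ
    by_cases h : (ℵ₀ ≤ κ ∧ σ.card ≤ κ ∧ κ < μ ∧
        (∀ (E : Type (u + 1)) [Nonempty E], #E ≤ Cardinal.lift.{u + 1} (Order.succ κ) →
          GuessesBelow (Order.succ κ) E))
    · obtain ⟨h1, h2, h3, h4⟩ := h
      obtain ⟨F, w, hF, hFw⟩ := exists_finite_guesses h1 h4 (f := f) fun i hi => by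
        rw [hf i (hi.trans_le (ord_le_ord.2 (Order.succ_le_of_lt h3)))]
        exact (card_le_iff.1 h2).le
      exact ⟨F, w, hF, fun _ _ _ _ => hFw⟩
    · exact ⟨fun _ => ∅, fun _ => ∅, fun α => ⟨finite_empty, empty_subset _, finite_empty⟩,
        fun h1 h2 h3 h4 => absurd ⟨h1, h2, h3, h4⟩ h⟩
  choose F w hF hFw using H
  -- Combine these guesses: on the interval `[κ, κ⁺)` use those for `κ`.
  refine ⟨fun α => F α.card α, fun α => w α.card α, fun α => hF _ _, fun G hG l hl β hβ => ?_⟩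
  refine le_antisymm ((mk_set_le _).trans (mk_Iio_ord μ).le) (le_of_not_gt fun hlt => ?_)
  obtain ⟨ν₀, hν₀⟩ := Cardinal.mem_range_lift_of_le hlt.le
  rw [← hν₀, Cardinal.lift_lt] at hlt
  obtain ⟨M, hM, hlM⟩ : ∃ M < μ, ∀ x ∈ l, x.card ≤ M := by
    clear hν₀
    induction l with
    | nil => exact ⟨0, aleph0_pos.trans hμ, by simp⟩
    | cons a l ih =>
      obtain ⟨M, hM, h⟩ := ih fun x hx => hl x (List.mem_cons_of_mem _ hx)
      refine ⟨max a.card M, max_lt (lt_ord.1 (hl a List.mem_cons_self)) hM, fun x hx => ?_⟩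
      rcases List.mem_cons.1 hx with rfl | hx
      · exact le_max_left _ _
      · exact (h x hx).trans (le_max_right _ _)
  obtain ⟨κ, h0, hνκ, hκμ, hE⟩ := exists_le_lt_guessesBelow_succ hμ hGCH hdiamond
    (max_lt hlt (max_lt hM (max_lt (lt_ord.1 hβ) (lt_ord.1 hσμ))))
  simp only [max_le_iff] at hνκ
  obtain ⟨hν, hMκ, hβκ, hσκ⟩ := hνκ
  have hΛμ : (Order.succ κ).ord ≤ μ.ord := ord_le_ord.2 (Order.succ_le_of_lt hκμ)
  refine absurd (hν₀ ▸ Cardinal.lift_le.2 hν) (not_le.2 (lift_lt_mk_of_unbounded h0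
    fun γ hγ => ?_))
  obtain ⟨α, hα, hαΛ, h1, h2⟩ := hFw κ h0 hσκ hκμ hE G
    (fun g hg => ⟨hΛμ.trans (hG g hg).1.ge, fun i hi => (hG g hg).2 i (hi.trans_le hΛμ)⟩) l
    (fun x hx => card_le_iff.1 ((hlM x hx).trans hMκ)) (max γ (max β κ.ord))
    (max_lt hγ (max_lt (card_le_iff.1 hβκ) (ord_lt_ord.2 (Order.lt_succ κ))))
  simp only [max_lt_iff] at hα
  have hcard : α.card = κ := le_antisymm (card_le_iff.2 hαΛ) (ord_le.1 hα.2.2.le)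
  refine ⟨⟨α, hαΛ.trans_le hΛμ⟩, ⟨hα.2.1, ?_, ?_⟩, hα.1, hαΛ⟩
  · simpa only [hcard] using h1
  · simpa only [hcard] using h2

/-- The filter is generated by the final segments of `μ`, the sets where a given function is
guessed, and the sets where a given ordinal is guessed. -/
theorem exists_isOneSpecialFilter {σ : Ordinal.{u}} {f : Ordinal.{u} → Ordinal.{u}}
    (hμ : ℵ₀ < μ) (hσ : 0 < σ) (hσμ : σ < μ.ord) (hf : ∀ i < μ.ord, f i = σ)
    (hGCH : ∀ κ : Cardinal.{u}, ℵ₀ ≤ κ → κ < μ → (2 : Cardinal.{u}) ^ κ = Order.succ κ)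
    (hdiamond : μ = ℵ₁ → DiamondPrinciple μ) :
    ∃ (D : Filter (Iio μ.ord)) (F : Iio μ.ord → Set OrdSeq.{u}),
      IsOneSpecialFilter μ univ μ ℵ₀ f D ∧ IsGuessingWitness μ univ ℵ₀ f D F := by
  obtain ⟨F, w, hF, hcard⟩ := exists_finite_guesses_card hμ hσμ hf hGCH hdiamond
  have hlim : Order.IsSuccLimit μ.ord := isSuccLimit_ord hμ.le
  let D : Filter (Iio μ.ord) :=
    { sets := {B | ∃ G : List OrdSeq.{u}, (∀ g ∈ G, g ∈ OrdSeq.prod f μ.ord) ∧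
        ∃ l : List Ordinal.{u}, (∀ x ∈ l, x < μ.ord) ∧ ∃ β < μ.ord, ∀ α : Iio μ.ord, β < α.1 →
          (∀ g ∈ G, g.restrict α ∈ F α) → (∀ x ∈ l, x ∈ w α) → α ∈ B}
      univ_sets := ⟨[], by simp, [], by simp, 0, hlim.bot_lt, by simp⟩
      sets_of_superset := by
        rintro B B' ⟨G, hG, l, hl, β, hβ, h⟩ hB
        exact ⟨G, hG, l, hl, β, hβ, fun α h1 h2 h3 => hB (h α h1 h2 h3)⟩
      inter_sets := by
        rintro B B' ⟨G, hG, l, hl, β, hβ, h⟩ ⟨G', hG', l', hl', β', hβ', h'⟩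
        refine ⟨G ++ G', ?_, l ++ l', ?_, max β β', max_lt hβ hβ', fun α h1 h2 h3 => ⟨?_, ?_⟩⟩
        · exact fun g hg => (List.mem_append.1 hg).elim (hG g) (hG' g)
        · exact fun x hx => (List.mem_append.1 hx).elim (hl x) (hl' x)
        · exact h α ((le_max_left _ _).trans_lt h1) (fun g hg => h2 g (List.mem_append_left _ hg))
            fun x hx => h3 x (List.mem_append_left _ hx)
        · exact h' α ((le_max_right _ _).trans_lt h1)
            (fun g hg => h2 g (List.mem_append_right _ hg))
            fun x hx => h3 x (List.mem_append_right _ hx) }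
  have hwit : IsGuessingWitness μ univ ℵ₀ f D fun α => F α :=
    { subset := fun α _ => (hF α).2.1
      card_lt := fun α _ => by simpa using (hF α).1
      guess := fun g hg => ⟨[g], by simpa using hg, [], by simp, 0, hlim.bot_lt,
        fun α _ h _ => ⟨mem_univ _, h g (by simp)⟩⟩ }
  refine ⟨D, fun α => F α,
    { uncountable := hμ
      card_S := by rw [mk_univ, mk_Iio_ord]
      regular := ⟨fun ξ => {α | ξ.1 ∈ w α}, fun ξ => ?_, fun i => ?_⟩
      theta_le := hμ.le
      theta_regular := isRegular_aleph0
      uniform := ?_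
      cobounded := fun β => ⟨[], by simp, [], by simp, β, β.2, fun α h _ _ => h.le⟩
      S_mem := Filter.univ_mem
      complete := by rw [Cardinal.lift_aleph0]; exact Filter.cardinalInterFilter_aleph0 D
      f_range := fun i hi => by rw [hf i hi]; exact ⟨hσ, hσμ⟩
      witness := ⟨_, hwit⟩ }, hwit⟩
  · exact ⟨[], by simp, [ξ.1], fun x hx => by rw [List.mem_singleton.1 hx]; exact ξ.2, 0,
      hlim.bot_lt, fun α _ _ h => h _ (by simp)⟩
  · rw [Cardinal.lift_aleph0, Cardinal.lt_aleph0_iff_set_finite]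
    exact (hF i).2.2.preimage Subtype.val_injective.injOn
  · rintro B ⟨G, hG, l, hl, β, hβ, h⟩
    refine le_antisymm ((mk_set_le _).trans (mk_Iio_ord μ).le) ?_
    rw [← hcard G hG l hl β hβ]
    exact mk_le_mk_of_subset fun α hα => h α hα.1 hα.2.1 hα.2.2

end

/-! ### The tree that splits at the guesses -/

namespace OrdSeq

theorem restrict_len_of_le {η : OrdSeq.{u}} {α : Ordinal.{u}} (h : α ≤ η.len) :
    (η.restrict α).len = α :=
  min_eq_right h

theorem restrict_val_of_lt (η : OrdSeq.{u}) {α i : Ordinal.{u}} (h : i < α) :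
    (η.restrict α).val i = η.val i :=
  if_pos h

theorem restrict_restrict_of_le (η : OrdSeq.{u}) {α β : Ordinal.{u}} (h : α ≤ β) :
    (η.restrict β).restrict α = η.restrict α := by
  refine OrdSeq.ext ?_ (funext fun i => ?_)
  · simp [restrict, min_assoc, h]
  · by_cases hi : i < α
    · simp [restrict, hi, hi.trans_le h]
    · simp [restrict, hi]

theorem restrict_len_self (η : OrdSeq.{u}) : η.restrict η.len = η := by
  refine OrdSeq.ext (min_self _) (funext fun i => ?_)
  by_cases hi : i < η.len
  · exact if_pos hi
  · exact (if_neg hi).trans (η.val_eq_zero i (not_lt.1 hi)).symm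

theorem snoc_val_len (η : OrdSeq.{u}) (ζ : Ordinal.{u}) : (η.snoc ζ).val η.len = ζ :=
  if_pos rfl

theorem snoc_val_of_lt (η : OrdSeq.{u}) (ζ : Ordinal.{u}) {i : Ordinal.{u}} (h : i < η.len) :
    (η.snoc ζ).val i = η.val i :=
  if_neg h.ne

theorem snoc_restrict_of_le (η : OrdSeq.{u}) (ζ : Ordinal.{u}) {α : Ordinal.{u}}
    (h : α ≤ η.len) : (η.snoc ζ).restrict α = η.restrict α := by
  refine OrdSeq.ext ?_ (funext fun i => ?_)
  · exact (min_eq_right (h.trans (Order.le_succ _))).trans (min_eq_right h).symm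
  · by_cases hi : i < α
    · rw [restrict_val_of_lt _ hi, restrict_val_of_lt _ hi, snoc_val_of_lt _ _ (hi.trans_le h)]
    · simp [restrict, hi]

/-- The tree of the sequences of length `< δ` bounded by `f` which have the entry `0` at every
place `i` at which their restriction to `i` is not in `F i`. -/
def splittingTree (δ : Ordinal.{u}) (f : Ordinal.{u} → Ordinal.{u})
    (F : Iio δ → Set OrdSeq.{u}) : Set OrdSeq.{u} :=
  {η | η.len < δ ∧ ∀ i : Iio δ, i < η.len → η.val i < f i ∧ (η.restrict i ∉ F i → η.val i = 0)}

variable {δ : Ordinal.{u}} {f : Ordinal.{u} → Ordinal.{u}} {F : Iio δ → Set OrdSeq.{u}}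
  {η : OrdSeq.{u}}

theorem mem_suc_splittingTree (hδ : Order.IsSuccLimit δ) (hη : η ∈ splittingTree δ f F)
    {ζ : Ordinal.{u}} : ζ ∈ suc (splittingTree δ f F) η ↔
      ζ < f η.len ∧ (η ∉ F ⟨η.len, hη.1⟩ → ζ = 0) := by
  constructor
  · intro h
    have := h.2 ⟨η.len, hη.1⟩ (Order.lt_succ _)
    rwa [snoc_val_len, snoc_restrict_of_le _ _ le_rfl, restrict_len_self] at this
  · refine fun h => ⟨hδ.succ_lt hη.1, fun i hi => ?_⟩
    rcases (Order.lt_succ_iff.1 hi).eq_or_lt with hi | hi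
    · obtain rfl : i = ⟨η.len, hη.1⟩ := Subtype.ext hi
      rwa [snoc_val_len, snoc_restrict_of_le _ _ le_rfl, restrict_len_self]
    · rw [snoc_val_of_lt _ _ hi, snoc_restrict_of_le _ _ hi.le]
      exact hη.2 i hi

theorem suc_splittingTree_of_mem (hδ : Order.IsSuccLimit δ) (hη : η ∈ splittingTree δ f F)
    (h : η ∈ F ⟨η.len, hη.1⟩) : suc (splittingTree δ f F) η = Iio (f η.len) := by
  ext ζ
  simp [mem_suc_splittingTree hδ hη, h]

theorem sucIsSingleton_splittingTree_iff (hδ : Order.IsSuccLimit δ) (hf : ∀ i < δ, 1 < f i)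
    (hη : η ∈ splittingTree δ f F) :
    SucIsSingleton (splittingTree δ f F) η ↔ η ∉ F ⟨η.len, hη.1⟩ := by
  refine ⟨fun ⟨ζ, hζ⟩ h => ?_, fun h => ⟨0, ?_⟩⟩
  · rw [suc_splittingTree_of_mem hδ hη h] at hζ
    have h1 : (1 : Ordinal.{u}) ∈ ({ζ} : Set Ordinal.{u}) := hζ ▸ hf _ hη.1
    have h0 : (0 : Ordinal.{u}) ∈ ({ζ} : Set Ordinal.{u}) :=
      hζ ▸ zero_lt_one.trans (hf _ hη.1)
    exact one_ne_zero (h1.trans h0.symm)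
  · ext ζ
    rw [mem_suc_splittingTree hδ hη]
    exact ⟨fun H => H.2 h, fun H => ⟨H.symm ▸ zero_lt_one.trans (hf _ hη.1), fun _ => H⟩⟩

theorem isSpecialTree_splittingTree (hδ : Order.IsSuccLimit δ) (hf0 : ∀ i < δ, 0 < f i)
    (hf : ∀ i < δ, f i ≤ δ) : IsSpecialTree δ (splittingTree δ f F) where
  subset η hη := ⟨hη.1, fun i hi =>
    (hη.2 ⟨i, hi.trans hη.1⟩ hi).1.trans_le (hf i (hi.trans hη.1))⟩
  no_maximal η hη := ⟨η.snoc 0, (mem_suc_splittingTree hδ hη).2 ⟨hf0 _ hη.1, fun _ => rfl⟩,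
    Order.lt_succ _, by rw [snoc_restrict_of_le _ _ le_rfl, restrict_len_self]⟩
  empty_mem := ⟨hδ.bot_lt, fun i hi => absurd hi (not_lt_bot)⟩
  restrict_mem η hη α hα := by
    refine ⟨(restrict_len_of_le hα.le).trans_lt (hα.trans hη.1), fun i hi => ?_⟩
    rw [restrict_len_of_le hα.le] at hi
    rw [restrict_val_of_lt _ hi, restrict_restrict_of_le _ hi.le]
    exact hη.2 i (hi.trans hα)
  closed η hη h := by
    refine ⟨hη.1, fun i hi => ?_⟩
    have := (h i hi).2 i (by
      rw [restrict_len_of_le (Order.succ_le_of_lt hi)]; exact Order.lt_succ _)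
    rwa [restrict_val_of_lt _ (Order.lt_succ _),
      restrict_restrict_of_le _ (Order.le_succ _)] at this

theorem mem_prod_of_mem_lim_splittingTree (hδ : Order.IsSuccLimit δ)
    (hη : η ∈ lim δ (splittingTree δ f F)) : η ∈ prod f δ := by
  refine ⟨hη.1, fun i hi => ?_⟩
  have hs := hδ.succ_lt hi
  have := ((hη.2 _ hs).2 ⟨i, hi⟩ (by
    rw [restrict_len_of_le (hs.le.trans hη.1.ge)]; exact Order.lt_succ _)).1
  rwa [restrict_val_of_lt _ (Order.lt_succ _)] at this

theorem mk_splittingTree_le {μ : Cardinal.{u}} {σ : Ordinal.{u}} (hμ : ℵ₀ < μ)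
    (hσμ : σ < μ.ord) (hf : ∀ i < μ.ord, f i ≤ σ)
    (hGCH : ∀ κ : Cardinal.{u}, ℵ₀ ≤ κ → κ < μ → (2 : Cardinal.{u}) ^ κ = Order.succ κ)
    {F : Iio μ.ord → Set OrdSeq.{u}} :
    #(splittingTree μ.ord f F) ≤ Cardinal.lift.{u + 1} μ := by
  let j (η : splittingTree μ.ord f F) : Σ α : Iio μ.ord, (Iio α.1 → Iio σ) :=
    ⟨⟨η.1.len, η.2.1⟩, fun i => ⟨η.1.val i, (η.2.2 ⟨i, (mem_Iio.1 i.2).trans η.2.1⟩ i.2).1.trans_le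
      (hf i ((mem_Iio.1 i.2).trans η.2.1))⟩⟩
  have hj : Function.Injective j := by
    rintro ⟨⟨a, x, hx⟩, hη⟩ ⟨⟨a', x', hx'⟩, hη'⟩ h
    obtain ⟨h1, h2⟩ := Sigma.mk.inj h
    obtain rfl : a = a' := congrArg Subtype.val h1
    refine Subtype.ext (OrdSeq.ext rfl (funext fun i => ?_))
    rcases lt_or_ge i a with hi | hi
    · exact congrArg Subtype.val (congrFun (eq_of_heq h2) ⟨i, hi⟩)
    · exact (hx i hi).trans (hx' i hi).symm
  refine (mk_le_of_injective hj).trans ?_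
  rw [Cardinal.mk_sigma]
  have hle : ∀ α : Iio μ.ord, #(Iio α.1 → Iio σ) ≤ Cardinal.lift.{u + 1} μ := fun α => by
    have hK : max ℵ₀ (max σ.card α.1.card) < μ :=
      max_lt hμ (max_lt (lt_ord.1 hσμ) (lt_ord.1 α.2))
    have h0 : ℵ₀ ≤ max ℵ₀ (max σ.card α.1.card) := le_max_left _ _
    rw [← power_def, Cardinal.mk_Iio_ordinal, Cardinal.mk_Iio_ordinal, ← Cardinal.lift_power,
      Cardinal.lift_le]
    refine (power_le_two_power h0 (((le_max_left _ _).trans (le_max_right _ _)).trans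
      (cantor _).le) ((le_max_right _ _).trans (le_max_right _ _))).trans ?_
    rw [hGCH _ h0 hK]
    exact Order.succ_le_of_lt hK
  refine (Cardinal.sum_le_sum _ _ hle).trans ?_
  rw [Cardinal.sum_const', mk_Iio_ord]
  exact (mul_eq_self (Cardinal.aleph0_le_lift.2 hμ.le)).le

end OrdSeq

theorem IsOneSpecialFilter.isTwoSpecialPair_splittingTree {μ : Cardinal.{u}} {σ : Ordinal.{u}}
    {f : Ordinal.{u} → Ordinal.{u}} {D : Filter (Iio μ.ord)} {F : Iio μ.ord → Set OrdSeq.{u}}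
    (hD : IsOneSpecialFilter μ univ μ ℵ₀ f D) (hF : IsGuessingWitness μ univ ℵ₀ f D F)
    (hσ : 1 < σ) (hσμ : σ < μ.ord) (hf : ∀ i < μ.ord, f i = σ)
    (hGCH : ∀ κ : Cardinal.{u}, ℵ₀ ≤ κ → κ < μ → (2 : Cardinal.{u}) ^ κ = Order.succ κ) :
    IsTwoSpecialPair μ univ μ ℵ₀ f D (OrdSeq.splittingTree μ.ord f F) := by
  have hlim : Order.IsSuccLimit μ.ord := isSuccLimit_ord hD.uncountable.le
  have hf1 : ∀ i < μ.ord, 1 < f i := fun i hi => (hf i hi).symm ▸ hσ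
  have htree : IsSpecialTree μ.ord (OrdSeq.splittingTree μ.ord f F) :=
    OrdSeq.isSpecialTree_splittingTree hlim (fun i hi => (hD.f_range i hi).1)
      fun i hi => (hD.f_range i hi).2.le
  exact
    { kappa_le := le_rfl
      theta_lt := hD.uncountable
      theta_regular := hD.theta_regular
      sup_S := by
        rw [image_univ, Subtype.range_coe]
        exact hlim.isLUB_Iio
      f_range := fun i hi => (hD.f_range i hi).2.trans (Order.lt_succ _)
      oneSpecial := hD
      complete := hD.complete
      S_mem := hD.S_mem
      subset_prod := fun η hη =>
        ⟨hη.1, rfl, fun i hi => (hη.2 ⟨i, hi.trans hη.1⟩ hi).1⟩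
      card_le := OrdSeq.mk_splittingTree_le hD.uncountable hσμ (fun i hi => (hf i hi).le) hGCH
      lean := ⟨htree, fun α hα => by
        refine lt_of_le_of_lt (mk_le_mk_of_subset ?_) (hF.card_lt ⟨α, hα⟩ (mem_univ _))
        rintro η ⟨hη, rfl, hs⟩
        by_contra h
        exact hs ((OrdSeq.sucIsSingleton_splittingTree_iff hlim hf1 hη).2 h)⟩
      special :=
        { theta_le := hD.theta_le
          theta_regular := hD.theta_regular
          limit := hlim
          le_delta := le_rfl
          regular := hD.regular
          tree := htree
          branch := fun η hη => by
            refine Filter.mem_of_superset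
              (hF.guess η (OrdSeq.mem_prod_of_mem_lim_splittingTree hlim hη)) fun α hα hs => ?_
            have hT := hη.2 α.1 α.2
            rw [OrdSeq.sucIsSingleton_splittingTree_iff hlim hf1 hT] at hs
            have hlen : (⟨(η.restrict α.1).len, hT.1⟩ : Iio μ.ord) = α :=
              Subtype.ext (OrdSeq.restrict_len_of_le ((mem_Iio.1 α.2).le.trans hη.1.ge))
            exact hs (hlen.symm ▸ hα.2) }
      full := fun η hη hs => by
        rw [OrdSeq.sucIsSingleton_splittingTree_iff hlim hf1 hη, not_not] at hs
        exact OrdSeq.suc_splittingTree_of_mem hlim hη hs }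

theorem mainTheorem8 (μ : Cardinal.{u}) (σ : Ordinal.{u}) (f : Ordinal.{u} → Ordinal.{u})
    (hμ : ℵ₀ < μ)
    (hσ : 0 < σ) (hσμ : σ < μ.ord)
    (hf : ∀ i < μ.ord, f i = σ)
    (hGCH : ∀ κ : Cardinal.{u}, ℵ₀ ≤ κ → κ < μ → (2 : Cardinal.{u}) ^ κ = Order.succ κ)
    (hdiamond : μ = ℵ₁ → DiamondPrinciple μ) :
    (∃ D : Filter (Iio μ.ord), IsOneSpecialFilter μ univ μ ℵ₀ f D) ∧
      (1 < σ → ∃ (D : Filter (Iio μ.ord)) (T : Set OrdSeq.{u}),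
        IsTwoSpecialPair μ univ μ ℵ₀ f D T) := by
  obtain ⟨D, F, hD, hF⟩ := exists_isOneSpecialFilter hμ hσ hσμ hf hGCH hdiamond
  exact ⟨⟨D, hD⟩, fun h1 => ⟨D, _, hD.isTwoSpecialPair_splittingTree hF h1 hσμ hf hGCH⟩⟩
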